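/- Let $(V,E)$ be a connected, locally finite, undirected graph (finite or infinite, self-loops allowed), let $m:V\to(0,\infty)$ be a vertex weight and $\mu$ a symmetric edge weight, $\mu_{xy}=\mu_{yx}>0$ for $x\sim y$, extended by $\mu_{xy}=0$ for $x\not\sim y$. For $f:V\to\mathbb R$ put $$\Gamma(f)(x)=\frac{1}{2m(x)}\sum_{y\in V}\mu_{xy}(f(y)-f(x))^2,\qquad Q(f)=\frac12\sum_{x,y\in V}\mu_{xy}(f(y)-f(x))^2\in[0,\infty],$$ and let $C_0(V)$ be the set of finitely supported real functions on $V$. Assume that the weighted graph is complete, i.e. there is a pointwise nondecreasing sequence $\eta_1\le\eta_2\le\dots$ in $C_0(V)$ with $\eta_k\to 1$ pointwise and $\Gamma(\eta_k)\le\frac1k$ on $V$ for all $k\geq 1$. Let $D(Q^{(N)})=\{f\in\ell^2(V,m): Q(f)<\infty\}$ and let $D(Q^{(D)})$ be the closure of $C_0(V)$ in $D(Q^{(N)})$ with respect to the norm $\|f\|_Q=(\|f\|_{\ell^2(V,m)}^2+Q(f))^{1/2}$. Let $L$ be the nonpositive self-adjoint operator on $\ell^2(V,m)$ associated with the form $Q(f,g)=\frac12\sum_{x,y}\mu_{xy}(f(y)-f(x))(g(y)-g(x))$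 on $D(Q^{(D)})$, that is, $f\in D(L)$ and $Lf=h$ if and only if $f\in D(Q^{(D)})$, $h\in\ell^2(V,m)$ and $Q(f,g)=-\langle h,g\rangle_{\ell^2(V,m)}$ for all $g\in D(Q^{(D)})$. Let $P_t=e^{tL}$, $t\ge0$, be the heat semigroup, i.e. the $C_0$-semigroup on $\ell^2(V,m)$ with infinitesimal generator $L$. Then $D(Q^{(D)})=D(Q^{(N)})=:D(Q)$, and for every $f\in C_0(V)$, $$Q(P_tf)\le Q(f)\qquad\text{for all } t\ge 0.$$ Moreover, the same inequality holds for every $f\in D(Q)$ and all $t\ge 0$. -/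

import Mathlib

open Filter Topology MeasureTheory
open scoped ENNReal

section
variable {E : Type*} [NormedAddCommGroup E] [InnerProductSpace ℝ E] [CompleteSpace E]

/-- `P t`, `t ≥ 0`, is a `C₀`-semigroup (strongly continuous one-parameter semigroup); the values
at negative `t` are irrelevant. -/
structure IsC0Semigroup (P : ℝ → E →L[ℝ] E) : Prop where
  zero : P 0 = 1
  add : ∀ s t : ℝ, 0 ≤ s → 0 ≤ t → P (s + t) = P s * P t
  continuousOn : ∀ f : E, ContinuousOn (fun t => P t f) (Set.Ici 0)

/-- The operator with graph `{(f, h) | A f h}` is the infinitesimal generator of `P`: `f` is in its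
domain with value `h` iff `(P_t f - f) / t → h` as `t ↓ 0`. -/
def IsInfinitesimalGenerator (A : E → E → Prop) (P : ℝ → E →L[ℝ] E) : Prop :=
  ∀ f h : E, A f h ↔ Tendsto (fun t : ℝ => t⁻¹ • (P t f - f)) (𝓝[>] 0) (𝓝 h)

theorem exp_hasDerivAt (B : E →L[ℝ] E) (f : E) (t : ℝ) :
    HasDerivAt (fun s : ℝ => NormedSpace.exp (s • B) f) (B (NormedSpace.exp (t • B) f)) t := by
  have h := hasDerivAt_exp_smul_const' (𝕂 := ℝ) B t
  exact ((ContinuousLinearMap.apply ℝ E f).hasFDerivAt.comp_hasDerivAt t h)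

theorem exp_contraction {B : E →L[ℝ] E} (hB : ∀ f, inner ℝ (B f) f ≤ 0) {t : ℝ} (ht : 0 ≤ t)
    (f : E) : ‖NormedSpace.exp (t • B) f‖ ≤ ‖f‖ := by
  have hd : ∀ s : ℝ, HasDerivAt (fun s : ℝ => ‖NormedSpace.exp (s • B) f‖ ^ 2)
      (2 * inner ℝ (NormedSpace.exp (s • B) f) (B (NormedSpace.exp (s • B) f))) s :=
    fun s => (exp_hasDerivAt B f s).norm_sq
  have ha : Antitone (fun s : ℝ => ‖NormedSpace.exp (s • B) f‖ ^ 2) := by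
    apply antitone_of_deriv_nonpos (fun s => (hd s).differentiableAt)
    intro s
    rw [(hd s).deriv, real_inner_comm]
    have := hB (NormedSpace.exp (s • B) f)
    linarith
  have h0 := ha ht
  simp only [zero_smul, NormedSpace.exp_zero, one_apply_eq_self] at h0
  exact le_of_sq_le_sq h0 (norm_nonneg _)

theorem exp_diff {B C : E →L[ℝ] E} (hB : ∀ f, inner ℝ (B f) f ≤ 0)
    (hC : ∀ f, inner ℝ (C f) f ≤ 0) (hcomm : Commute B C) {t : ℝ} (ht : 0 ≤ t) (f : E) :
    ‖NormedSpace.exp (t • B) f - NormedSpace.exp (t • C) f‖ ≤ t * ‖B f - C f‖ := by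
  have hc : ∀ s : ℝ, NormedSpace.exp (s • (B - C)) * NormedSpace.exp (t • C)
      = NormedSpace.exp (s • B + (t - s) • C) := by
    intro s
    have hcc : Commute (s • (B - C)) (t • C) :=
      ((hcomm.sub_left (Commute.refl C)).smul_left s).smul_right t
    let _ : NormedAlgebra ℚ (E →L[ℝ] E) := NormedAlgebra.restrictScalars ℚ ℝ _
    rw [← NormedSpace.exp_add_of_commute hcc]
    congr 1
    module
  have hd : ∀ s : ℝ, HasDerivAt
      (fun s : ℝ => NormedSpace.exp (s • (B - C)) (NormedSpace.exp (t • C) f))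
      (NormedSpace.exp (s • (B - C)) (NormedSpace.exp (t • C) (B f - C f))) s := by
    intro s
    have h := hasDerivAt_exp_smul_const (𝕂 := ℝ) (B - C) s
    have h2 := ((ContinuousLinearMap.apply ℝ E (NormedSpace.exp (t • C) f)).hasFDerivAt.comp_hasDerivAt s h)
    refine h2.congr_deriv ?_
    have : Commute (B - C) (NormedSpace.exp (t • C)) :=
      (((hcomm.sub_left (Commute.refl C)).smul_right t)).exp_right
    have h3 := congrArg (fun T : E →L[ℝ] E => T f) this.eq
    simp only [mul_apply_eq_comp] at h3
    exact congrArg (fun v : E => NormedSpace.exp (s • (B - C)) v) h3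
  have := norm_image_sub_le_of_norm_deriv_le_segment' (a := 0) (b := t)
    (f := fun s : ℝ => NormedSpace.exp (s • (B - C)) (NormedSpace.exp (t • C) f))
    (C := ‖B f - C f‖) (fun s _ => (hd s).hasDerivWithinAt) (by
      intro s hs
      rw [← mul_apply_eq_comp, hc s]
      have := exp_contraction (B := s • B + (t - s) • C) (by
        intro g
        simp only [add_apply, smul_apply, inner_add_left,
          real_inner_smul_left]
        have h1 := mul_nonpos_of_nonneg_of_nonpos hs.1 (hB g)
        have h2 := mul_nonpos_of_nonneg_of_nonpos (sub_nonneg.2 hs.2.le) (hC g)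
        linarith) zero_le_one (B f - C f)
      simpa using this) t (Set.right_mem_Icc.2 ht)
  rw [← mul_apply_eq_comp, hc t] at this
  simp at this
  linarith

/-- A maximal dissipative operator with trivial multivalued part generates a `C₀`-semigroup. -/
theorem exists_semigroup (A : Submodule ℝ (E × E)) (hinj : ∀ h, ((0 : E), h) ∈ A → h = 0)
    (hdis : ∀ f h, (f, h) ∈ A → inner ℝ h f ≤ 0) (J : ℕ → E →L[ℝ] E)
    (hJ1 : ∀ n g, ‖J n g‖ ≤ ‖g‖)
    (hJ : ∀ (n : ℕ) g, (J n g, ((n : ℝ) + 1) • (J n g - g)) ∈ A) :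
    ∃ P : ℝ → E →L[ℝ] E, IsC0Semigroup P ∧
      IsInfinitesimalGenerator (fun f h => (f, h) ∈ A) P := by
  have hpos : ∀ n : ℕ, (0 : ℝ) < (n : ℝ) + 1 := fun n => by positivity
  -- the resolvent inverts the operator
  have hinv : ∀ (n : ℕ) f h, (f, h) ∈ A → J n (f - ((n : ℝ) + 1)⁻¹ • h) = f := by
    intro n f h hf
    set u := J n (f - ((n : ℝ) + 1)⁻¹ • h) with hu
    have h1 := A.sub_mem (hJ n (f - ((n : ℝ) + 1)⁻¹ • h)) hf
    rw [← hu] at h1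
    have h2 : ((n : ℝ) + 1) • (u - (f - ((n : ℝ) + 1)⁻¹ • h)) - h = ((n : ℝ) + 1) • (u - f) := by
      rw [smul_sub, smul_sub, smul_inv_smul₀ (hpos n).ne', smul_sub]; abel
    simp only [Prod.mk_sub_mk] at h1
    rw [h2] at h1
    have h3 := hdis _ _ h1
    rw [real_inner_smul_left, real_inner_self_eq_norm_sq] at h3
    have h4 : ‖u - f‖ ^ 2 ≤ 0 := by
      by_contra hh
      push Not at hh
      have := mul_pos (hpos n) hh
      linarith
    have h5 : ‖u - f‖ = 0 := by nlinarith [norm_nonneg (u - f)]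
    exact sub_eq_zero.1 (norm_eq_zero.1 h5)
  set B : ℕ → E →L[ℝ] E := fun n => ((n : ℝ) + 1) • (J n - 1) with hBdef
  have hBapp : ∀ n f, B n f = ((n : ℝ) + 1) • (J n f - f) := fun n f => rfl
  have hBJ : ∀ (n : ℕ) f h, (f, h) ∈ A → B n f = J n h := by
    intro n f h hf
    have := hinv n f h hf
    rw [map_sub, map_smul] at this
    rw [hBapp, sub_eq_iff_eq_add.1 this, add_sub_cancel_left, smul_inv_smul₀ (hpos n).ne']
  have hinvar : ∀ (n : ℕ) f h, (f, h) ∈ A → (J n f, J n h) ∈ A := by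
    intro n f h hf
    have := hJ n f
    rwa [← hBapp, hBJ n f h hf] at this
  have hJcomm : ∀ n m, Commute (J n) (J m) := by
    intro n m
    ext g
    simp only [mul_apply_eq_comp]
    have h1 := hinvar n _ _ (hJ m g)
    have h2 := hinv m _ _ h1
    rw [map_smul, inv_smul_smul₀ (hpos m).ne', map_sub (J n), map_sub (J m), map_sub (J m),
      sub_sub_cancel] at h2
    exact h2.symm
  have hBcomm : ∀ n m, Commute (B n) (B m) := by
    intro n m
    exact ((((hJcomm n m).sub_right (Commute.one_right _)).sub_left
      (Commute.one_left _)).smul_left _).smul_right _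
  have hBdis : ∀ n f, inner ℝ (B n f) f ≤ 0 := by
    intro n f
    rw [hBapp, real_inner_smul_left, inner_sub_left, real_inner_self_eq_norm_sq]
    have h1 := real_inner_le_norm (J n f) f
    have h2 := mul_le_mul_of_nonneg_right (hJ1 n f) (norm_nonneg f)
    apply mul_nonpos_of_nonneg_of_nonpos (hpos n).le
    nlinarith
  -- the domain is dense
  set D : Submodule ℝ E := A.map (LinearMap.fst ℝ E E) with hD
  have hDmem : ∀ f, f ∈ D ↔ ∃ h, (f, h) ∈ A := by
    intro f; simp [hD]
  have hdense : Dense (D : Set E) := by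
    rw [Submodule.dense_iff_topologicalClosure_eq_top, Submodule.topologicalClosure_eq_top_iff,
      Submodule.eq_bot_iff]
    intro g hg
    have h1 := hJ 0 g
    have h2 := hg (J 0 g) ((hDmem _).2 ⟨_, h1⟩)
    have h3 := hdis _ _ h1
    simp only [Nat.cast_zero, zero_add, one_smul, inner_sub_left, real_inner_self_eq_norm_sq] at h3
    rw [real_inner_comm] at h2
    have h5 : J 0 g = 0 := by
      apply norm_eq_zero.1
      nlinarith [norm_nonneg (J 0 g)]
    rw [h5] at h1
    have := hinj _ h1
    simpa using this
  -- the approximating semigroups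
  set S : ℕ → ℝ → E →L[ℝ] E := fun n t => NormedSpace.exp (t • B n) with hS
  have hS1 : ∀ n t, 0 ≤ t → ∀ f, ‖S n t f‖ ≤ ‖f‖ := fun n t ht f => exp_contraction (hBdis n) ht f
  have hJlim : ∀ g, Tendsto (fun n => J n g) atTop (𝓝 g) := by
    intro g
    rw [Metric.tendsto_atTop]
    intro ε hε
    obtain ⟨f, hf, hfg⟩ := Metric.mem_closure_iff.1 (hdense g) (ε / 3) (by positivity)
    obtain ⟨h, hfh⟩ := (hDmem f).1 hf
    obtain ⟨N, hN⟩ := exists_nat_gt (‖h‖ / (ε / 3))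
    refine ⟨N, fun n hn => ?_⟩
    have e1 : J n f - f = ((n : ℝ) + 1)⁻¹ • J n h := by
      rw [← hBJ n f h hfh, hBapp, inv_smul_smul₀ (hpos n).ne']
    have e2 : ‖J n f - f‖ < ε / 3 := by
      rw [e1, norm_smul, norm_inv, Real.norm_of_nonneg (hpos n).le, inv_mul_lt_iff₀ (hpos n)]
      have : (N : ℝ) ≤ n := by exact_mod_cast hn
      rw [div_lt_iff₀ (by positivity)] at hN
      have := hJ1 n h
      nlinarith
    have e3 := hJ1 n (g - f)
    rw [dist_eq_norm] at hfg ⊢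
    have e4 : J n g - g = J n (g - f) + (J n f - f) - (g - f) := by rw [map_sub]; abel
    rw [e4]
    calc _ ≤ ‖J n (g - f)‖ + ‖J n f - f‖ + ‖g - f‖ :=
          (norm_sub_le _ _).trans (by gcongr; exact norm_add_le _ _)
      _ < ε := by linarith
  have hcauchy : ∀ t, 0 ≤ t → ∀ f, CauchySeq (fun n => S n t f) := by
    intro t ht g
    rw [Metric.cauchySeq_iff]
    intro ε hε
    obtain ⟨f, hf, hfg⟩ := Metric.mem_closure_iff.1 (hdense g) (ε / 3) (by positivity)
    obtain ⟨h, hfh⟩ := (hDmem f).1 hf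
    obtain ⟨N, hN⟩ := Metric.cauchySeq_iff.1 (hJlim h).cauchySeq (ε / 3 / (t + 1)) (by positivity)
    refine ⟨N, fun m hm n hn => ?_⟩
    have e1 := hN m hm n hn
    rw [dist_eq_norm] at e1 hfg ⊢
    have e2 := exp_diff (hBdis m) (hBdis n) (hBcomm m n) ht f
    rw [hBJ m f h hfh, hBJ n f h hfh] at e2
    have e3 : S m t g - S n t g = S m t (g - f) - S n t (g - f) + (S m t f - S n t f) := by
      simp only [map_sub]; abel
    have e4 : ‖S m t f - S n t f‖ < ε / 3 := by
      rw [lt_div_iff₀ (by positivity)] at e1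
      refine lt_of_le_of_lt e2 (lt_of_le_of_lt ?_ e1)
      nlinarith [norm_nonneg (J m h - J n h)]
    rw [e3]
    calc _ ≤ ‖S m t (g - f)‖ + ‖S n t (g - f)‖ + ‖S m t f - S n t f‖ :=
          (norm_add_le _ _).trans (by gcongr; exact norm_sub_le _ _)
      _ < ε := by linarith [hS1 m t ht (g - f), hS1 n t ht (g - f)]
  have hex : ∀ t : ℝ, ∃ T : E →L[ℝ] E, 0 ≤ t → ∀ f, Tendsto (fun n => S n t f) atTop (𝓝 (T f)) := by
    intro t
    by_cases ht : 0 ≤ t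
    · choose T hT using fun f => cauchySeq_tendsto_of_complete (hcauchy t ht f)
      exact ⟨continuousLinearMapOfTendsto (S · t) (tendsto_pi_nhds.2 hT), fun _ f => hT f⟩
    · exact ⟨0, fun h => absurd h ht⟩
  choose P hP using hex
  have hP1 : ∀ t, 0 ≤ t → ∀ f, ‖P t f‖ ≤ ‖f‖ := fun t ht f =>
    le_of_tendsto (hP t ht f).norm (Eventually.of_forall fun n => hS1 n t ht f)
  -- first order estimate
  have hfirst : ∀ f h y, (f, h) ∈ A → ∀ (n : ℕ) (t M : ℝ), 0 ≤ t →
      (∀ s ∈ Set.Ico 0 t, ‖S n s (J n h) - y‖ ≤ M) → ‖S n t f - f - t • y‖ ≤ M * t := by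
    intro f h y hfh n t M ht hM
    have := norm_image_sub_le_of_norm_deriv_le_segment' (a := 0) (b := t)
      (f := fun s : ℝ => S n s f - s • y) (C := M) (f' := fun s => S n s (J n h) - y)
      (fun s _ => by
        have h1 := ((ContinuousLinearMap.apply ℝ E f).hasFDerivAt.comp_hasDerivAt s
          (hasDerivAt_exp_smul_const (𝕂 := ℝ) (B n) s))
        have h2 := (h1.sub ((hasDerivAt_id s).smul_const y)).hasDerivWithinAt (s := Set.Icc 0 t)
        simp only [one_smul] at h2
        refine h2.congr_deriv ?_
        rw [← hBJ n f h hfh]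
        rfl) hM t (Set.right_mem_Icc.2 ht)
    simp only [hS, zero_smul, NormedSpace.exp_zero, one_apply_eq_self, sub_zero] at this
    rw [sub_right_comm]
    exact this
  have hLip : ∀ f h, (f, h) ∈ A → ∀ (n : ℕ) (t : ℝ), 0 ≤ t → ‖S n t f - f‖ ≤ ‖h‖ * t := by
    intro f h hfh n t ht
    have := hfirst f h 0 hfh n t ‖h‖ ht (fun s hs => by
      rw [sub_zero]; exact (hS1 n s hs.1 _).trans (hJ1 n h))
    simpa using this
  have hSadd : ∀ n s t, S n (s + t) = S n s * S n t := by
    intro n s t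
    let _ : NormedAlgebra ℚ (E →L[ℝ] E) := NormedAlgebra.restrictScalars ℚ ℝ _
    simp only [hS]
    rw [add_smul, NormedSpace.exp_add_of_commute (((Commute.refl (B n)).smul_left s).smul_right t)]
  have hzero : P 0 = 1 := by
    ext f
    refine tendsto_nhds_unique (hP 0 le_rfl f) ?_
    simp [hS, NormedSpace.exp_zero]
  have hadd : ∀ s t : ℝ, 0 ≤ s → 0 ≤ t → P (s + t) = P s * P t := by
    intro s t hs ht
    ext f
    refine tendsto_nhds_unique (hP (s + t) (add_nonneg hs ht) f) ?_
    rw [mul_apply_eq_comp]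
    have h1 : Tendsto (fun n => S n s (S n t f - P t f)) atTop (𝓝 0) := by
      refine squeeze_zero_norm (fun n => hS1 n s hs _) ?_
      have := ((hP t ht f).sub_const (P t f)).norm
      simpa using this
    have h2 := h1.add (hP s hs (P t f))
    rw [zero_add] at h2
    refine h2.congr fun n => ?_
    rw [hSadd, mul_apply_eq_comp, map_sub, sub_add_cancel]
  have hPLip : ∀ f h, (f, h) ∈ A → ∀ t : ℝ, 0 ≤ t → ‖P t f - f‖ ≤ ‖h‖ * t := fun f h hfh t ht =>
    le_of_tendsto ((hP t ht f).sub_const f).norm (Eventually.of_forall fun n => hLip f h hfh n t ht)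
  have hPLip2 : ∀ f h, (f, h) ∈ A → ∀ s t : ℝ, 0 ≤ s → 0 ≤ t → ‖P t f - P s f‖ ≤ ‖h‖ * |t - s| := by
    intro f h hfh
    have key : ∀ s t : ℝ, 0 ≤ s → s ≤ t → ‖P t f - P s f‖ ≤ ‖h‖ * |t - s| := by
      intro s t hs hst
      have e : P t f - P s f = P s (P (t - s) f - f) := by
        rw [map_sub, ← mul_apply_eq_comp, ← hadd s (t - s) hs (sub_nonneg.2 hst),
          add_sub_cancel]
      rw [e, abs_of_nonneg (sub_nonneg.2 hst)]
      exact (hP1 s hs _).trans (hPLip f h hfh _ (sub_nonneg.2 hst))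
    intro s t hs ht
    rcases le_total s t with hst | hst
    · exact key s t hs hst
    · rw [norm_sub_rev, abs_sub_comm]; exact key t s ht hst
  have hcont : ∀ f : E, ContinuousOn (fun t => P t f) (Set.Ici 0) := by
    intro g
    rw [Metric.continuousOn_iff]
    intro s hs ε hε
    obtain ⟨f, hf, hfg⟩ := Metric.mem_closure_iff.1 (hdense g) (ε / 3) (by positivity)
    obtain ⟨h, hfh⟩ := (hDmem f).1 hf
    refine ⟨ε / 3 / (‖h‖ + 1), by positivity, fun t ht hts => ?_⟩
    rw [dist_eq_norm] at hfg ⊢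
    rw [Real.dist_eq, lt_div_iff₀ (by positivity)] at hts
    have e1 := hPLip2 f h hfh s t hs ht
    have e2 : P t g - P s g = P t (g - f) - P s (g - f) + (P t f - P s f) := by
      simp only [map_sub]; abel
    rw [e2]
    calc _ ≤ ‖P t (g - f)‖ + ‖P s (g - f)‖ + ‖P t f - P s f‖ :=
          (norm_add_le _ _).trans (by gcongr; exact norm_sub_le _ _)
      _ < ε := by
          nlinarith [hP1 t ht (g - f), hP1 s hs (g - f), abs_nonneg (t - s)]
  refine ⟨P, ⟨hzero, hadd, hcont⟩, ?_⟩
  have hgen : ∀ f h, (f, h) ∈ A →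
      Tendsto (fun t : ℝ => t⁻¹ • (P t f - f)) (𝓝[>] 0) (𝓝 h) := by
    intro f h hfh
    rw [Metric.tendsto_nhdsWithin_nhds]
    intro ε hε
    obtain ⟨h', hh', hfg⟩ := Metric.mem_closure_iff.1 (hdense h) (ε / 6) (by positivity)
    obtain ⟨k, hk⟩ := (hDmem h').1 hh'
    rw [dist_eq_norm] at hfg
    refine ⟨ε / 6 / (‖k‖ + 1), by positivity, fun {t} ht htd => ?_⟩
    have ht0 : (0 : ℝ) < t := ht
    rw [Real.dist_eq, sub_zero, abs_of_pos ht0, lt_div_iff₀ (by positivity)] at htd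
    have hS2 : ∀ᶠ n in atTop, ‖S n t f - f - t • h‖ ≤ (2 * (ε / 3)) * t := by
      have hev := Metric.tendsto_atTop.1 (hJlim h) (ε / 6) (by positivity)
      obtain ⟨N, hN⟩ := hev
      filter_upwards [eventually_ge_atTop N] with n hn
      refine hfirst f h h hfh n t _ ht0.le fun s hs => ?_
      have e1 := hN n hn
      rw [dist_eq_norm] at e1
      have e2 : S n s (J n h) - h
          = S n s (J n h - h) + S n s (h - h') + (S n s h' - h') - (h - h') := by
        simp only [map_sub]; abel
      have e3 := hLip h' k hk n s hs.1
      rw [e2]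
      calc _ ≤ ‖S n s (J n h - h)‖ + ‖S n s (h - h')‖ + ‖S n s h' - h'‖ + ‖h - h'‖ :=
            (norm_sub_le _ _).trans (by gcongr; exact norm_add₃_le)
        _ ≤ 2 * (ε / 3) := by
            nlinarith [hS1 n s hs.1 (J n h - h), hS1 n s hs.1 (h - h'), norm_nonneg k, hs.2]
    have hlim := le_of_tendsto (((hP t ht0.le f).sub_const f).sub_const (t • h)).norm hS2
    have e : t⁻¹ • (P t f - f) - h = t⁻¹ • (P t f - f - t • h) := by
      rw [smul_sub t⁻¹ (P t f - f), inv_smul_smul₀ ht0.ne']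
    rw [dist_eq_norm, e, norm_smul, norm_inv, Real.norm_of_nonneg ht0.le, inv_mul_lt_iff₀ ht0]
    nlinarith
  intro f h
  refine ⟨hgen f h, fun hlim => ?_⟩
  have hu := hJ 0 (f - h)
  simp only [Nat.cast_zero, zero_add, one_smul] at hu
  set u := J 0 (f - h) with hudef
  have hw := hlim.sub (hgen _ _ hu)
  have e : h - (u - (f - h)) = f - u := by abel
  rw [e] at hw
  have hw2 : Tendsto (fun t : ℝ => t⁻¹ • (P t (f - u) - (f - u))) (𝓝[>] 0) (𝓝 (f - u)) := by
    refine hw.congr fun t => ?_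
    rw [← smul_sub, map_sub]
    congr 1
    abel
  have h1 : inner ℝ (f - u) (f - u) ≤ 0 := by
    refine le_of_tendsto (hw2.inner (tendsto_const_nhds (x := f - u))) ?_
    filter_upwards [self_mem_nhdsWithin] with t ht
    have ht0 : (0 : ℝ) < t := ht
    rw [real_inner_smul_left, inner_sub_left, real_inner_self_eq_norm_sq]
    have h1 := real_inner_le_norm (P t (f - u)) (f - u)
    have h2 := mul_le_mul_of_nonneg_right (hP1 t ht0.le (f - u)) (norm_nonneg (f - u))
    exact mul_nonpos_of_nonneg_of_nonpos (by positivity) (by nlinarith)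
  have h2 : f - u = 0 := real_inner_self_nonpos.1 h1
  have h3 : f = u := sub_eq_zero.1 h2
  have h4 : u - (f - h) = h := by rw [← h3]; abel
  rwa [h4, ← h3] at hu
end

/-- A connected, locally finite weighted graph with vertex weight `m` and symmetric edge weight
`μ`, the latter extended by zero to all pairs of vertices. Self-loops are allowed. -/
structure WeightedGraph (V : Type*) where
  Adj : V → V → Prop
  adj_symm : ∀ x y, Adj x y → Adj y x
  locallyFinite : ∀ x, {y | Adj x y}.Finite
  connected : ∀ x y, Relation.ReflTransGen Adj x y
  m : V → ℝ
  m_pos : ∀ x, 0 < m x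
  μ : V → V → ℝ
  μ_symm : ∀ x y, μ x y = μ y x
  μ_pos : ∀ x y, Adj x y → 0 < μ x y
  μ_eq_zero : ∀ x y, ¬ Adj x y → μ x y = 0

namespace WeightedGraph

variable {V : Type*} (G : WeightedGraph V)

/-- The carré du champ `Γ(f, g)(x) = (1 / 2m(x)) ∑_y μ_{xy} (f(y) - f(x)) (g(y) - g(x))`
(a finite sum, by local finiteness). -/
noncomputable def carreDuChamp (f g : V → ℝ) (x : V) : ℝ :=
  (2 * G.m x)⁻¹ * ∑' y, G.μ x y * ((f y - f x) * (g y - g x))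

/-- The graph is complete: there is a nondecreasing sequence `η 1 ≤ η 2 ≤ …` of finitely supported
functions converging pointwise to `1` with `Γ(η k) ≤ 1 / k` (in the indexing below, the `k`-th
function of the sequence is `η (k - 1)`). -/
def IsComplete : Prop :=
  ∃ η : ℕ → V → ℝ, (∀ k, (Function.support (η k)).Finite) ∧ Monotone η ∧
    (∀ x, Tendsto (fun k => η k x) atTop (𝓝 1)) ∧
    ∀ k x, G.carreDuChamp (η k) (η k) x ≤ 1 / ((k : ℝ) + 1)

/-- The energy `Q(f) = 1/2 ∑_{x,y} μ_{xy} (f(y) - f(x))² ∈ [0, ∞]` of an arbitrary function. -/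
noncomputable def energy (f : V → ℝ) : ℝ≥0∞ :=
  2⁻¹ * ∑' p : V × V, ENNReal.ofReal (G.μ p.1 p.2 * (f p.2 - f p.1) ^ 2)

/-- The bilinear form `Q(f, g) = 1/2 ∑_{x,y} μ_{xy} (f(y) - f(x)) (g(y) - g(x))`; the sum converges
absolutely when `f` and `g` have finite energy. -/
noncomputable def energyForm (f g : V → ℝ) : ℝ :=
  2⁻¹ * ∑' p : V × V, G.μ p.1 p.2 * ((f p.2 - f p.1) * (g p.2 - g p.1))

/-- The squared form norm `‖f‖_Q² = ∑_x f(x)² m(x) + Q(f) ∈ [0, ∞]`. -/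
noncomputable def formNormSq (f : V → ℝ) : ℝ≥0∞ :=
  ∑' x, ENNReal.ofReal (G.m x * f x ^ 2) + G.energy f

theorem μ_nonneg (x y : V) : 0 ≤ G.μ x y := by
  by_cases h : G.Adj x y
  · exact (G.μ_pos x y h).le
  · exact (G.μ_eq_zero x y h).ge

/-- The weighted difference of a function along all pairs. -/
noncomputable def edgeVec (f : V → ℝ) (p : V × V) : ℝ := √(G.μ p.1 p.2) * (f p.2 - f p.1)

theorem edgeVec_mul (f g : V → ℝ) (p : V × V) : G.edgeVec f p * G.edgeVec g p
    = G.μ p.1 p.2 * ((f p.2 - f p.1) * (g p.2 - g p.1)) := by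
  have := Real.mul_self_sqrt (G.μ_nonneg p.1 p.2)
  rw [edgeVec, edgeVec]
  linear_combination ((f p.2 - f p.1) * (g p.2 - g p.1)) * this

theorem edgeVec_sq (f : V → ℝ) (p : V × V) : G.edgeVec f p ^ 2
    = G.μ p.1 p.2 * (f p.2 - f p.1) ^ 2 := by
  rw [sq, edgeVec_mul, sq]

theorem memℓp_edgeVec {f : V → ℝ} (hf : G.energy f < ∞) : Memℓp (G.edgeVec f) 2 := by
  apply memℓp_gen
  have h1 : ∑' p : V × V, ENNReal.ofReal (G.μ p.1 p.2 * (f p.2 - f p.1) ^ 2) ≠ ∞ := by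
    intro h
    rw [energy, h, ENNReal.mul_top (by simp)] at hf
    exact lt_irrefl _ hf
  refine (ENNReal.summable_toReal h1).congr fun p => ?_
  rw [ENNReal.toReal_ofReal (mul_nonneg (G.μ_nonneg _ _) (sq_nonneg _)), ← edgeVec_sq]
  simp

theorem norm_edge_sq (z : lp (fun _ : V × V => ℝ) 2) :
    ENNReal.ofReal (‖z‖ ^ 2) = ∑' p, ENNReal.ofReal (z p ^ 2) := by
  have h := lp.hasSum_inner (𝕜 := ℝ) z z
  have h1 : ∀ p, inner ℝ (z p) (z p) = z p ^ 2 := fun p => by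
    rw [real_inner_self_eq_norm_sq, Real.norm_eq_abs, sq_abs]
  simp only [h1, real_inner_self_eq_norm_sq] at h
  rw [← h.tsum_eq, ENNReal.ofReal_tsum_of_nonneg (fun p => sq_nonneg _) h.summable]

theorem energy_eq_of_edge {f : V → ℝ} {c : ℝ} {z : lp (fun _ : V × V => ℝ) 2}
    (hz : ∀ p, z p = c * G.edgeVec f p) :
    ENNReal.ofReal (c ^ 2) * G.energy f = 2⁻¹ * ENNReal.ofReal (‖z‖ ^ 2) := by
  rw [norm_edge_sq, energy, mul_left_comm, ← ENNReal.tsum_mul_left]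
  congr 1
  refine tsum_congr fun p => ?_
  rw [hz, ← ENNReal.ofReal_mul (sq_nonneg c), mul_pow, edgeVec_sq]

theorem energyForm_eq_of_edge {f g : V → ℝ} {c : ℝ} {z w : lp (fun _ : V × V => ℝ) 2}
    (hz : ∀ p, z p = c * G.edgeVec f p) (hw : ∀ p, w p = c * G.edgeVec g p) :
    c ^ 2 * G.energyForm f g = 2⁻¹ * inner ℝ z w := by
  rw [lp.inner_eq_tsum, energyForm, mul_left_comm, ← tsum_mul_left]
  congr 1
  refine tsum_congr fun p => ?_
  rw [hz, hw, ← edgeVec_mul]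
  simp only [RCLike.inner_apply, conj_trivial]
  ring

theorem energy_add_le (f g : V → ℝ) : G.energy (f + g) ≤ 2 * G.energy f + 2 * G.energy g := by
  rw [energy, energy, energy, mul_left_comm, mul_left_comm 2 2⁻¹, ← mul_add]
  gcongr
  rw [← ENNReal.tsum_mul_left, ← ENNReal.tsum_mul_left, ← ENNReal.tsum_add]
  gcongr with p
  have h := G.μ_nonneg p.1 p.2
  rw [show (2 : ℝ≥0∞) = ENNReal.ofReal 2 by simp, ← ENNReal.ofReal_mul (by norm_num),
    ← ENNReal.ofReal_mul (by norm_num), ← ENNReal.ofReal_add (by positivity) (by positivity)]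
  apply ENNReal.ofReal_le_ofReal
  simp only [Pi.add_apply]
  nlinarith [mul_nonneg h (sq_nonneg ((f p.2 - f p.1) - (g p.2 - g p.1)))]

theorem formNormSq_add_le (f g : V → ℝ) :
    G.formNormSq (f + g) ≤ 2 * G.formNormSq f + 2 * G.formNormSq g := by
  have h1 : ∑' x, ENNReal.ofReal (G.m x * (f + g) x ^ 2) ≤
      2 * ∑' x, ENNReal.ofReal (G.m x * f x ^ 2) + 2 * ∑' x, ENNReal.ofReal (G.m x * g x ^ 2) := by
    rw [← ENNReal.tsum_mul_left, ← ENNReal.tsum_mul_left, ← ENNReal.tsum_add]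
    gcongr with x
    have h := (G.m_pos x).le
    rw [show (2 : ℝ≥0∞) = ENNReal.ofReal 2 by simp, ← ENNReal.ofReal_mul (by norm_num),
      ← ENNReal.ofReal_mul (by norm_num), ← ENNReal.ofReal_add (by positivity) (by positivity)]
    apply ENNReal.ofReal_le_ofReal
    simp only [Pi.add_apply]
    nlinarith [mul_nonneg h (sq_nonneg (f x - g x))]
  refine (add_le_add h1 (G.energy_add_le f g)).trans (le_of_eq ?_)
  simp only [formNormSq, mul_add]
  abel

theorem energy_smul (c : ℝ) (f : V → ℝ) :
    G.energy (c • f) = ENNReal.ofReal (c ^ 2) * G.energy f := by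
  rw [energy, energy, mul_left_comm, ← ENNReal.tsum_mul_left (a := ENNReal.ofReal (c ^ 2))]
  congr 1
  refine tsum_congr fun p => ?_
  rw [← ENNReal.ofReal_mul (sq_nonneg c)]
  simp only [Pi.smul_apply, smul_eq_mul]
  ring_nf

theorem formNormSq_smul (c : ℝ) (f : V → ℝ) :
    G.formNormSq (c • f) = ENNReal.ofReal (c ^ 2) * G.formNormSq f := by
  rw [formNormSq, formNormSq, energy_smul, mul_add, ← ENNReal.tsum_mul_left]
  congr 1
  refine tsum_congr fun p => ?_
  rw [← ENNReal.ofReal_mul (sq_nonneg c)]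
  simp only [Pi.smul_apply, smul_eq_mul]
  ring_nf

theorem energy_lt_top_of_finite {f : V → ℝ} (hf : (Function.support f).Finite) :
    G.energy f < ∞ := by
  set s : Set (V × V) := ((Function.support f) ×ˢ (⋃ x ∈ Function.support f, {y | G.Adj x y})) ∪
    ((⋃ x ∈ Function.support f, {y | G.Adj x y}) ×ˢ (Function.support f)) with hs
  have hfin : s.Finite := by
    have := hf.biUnion fun x _ => G.locallyFinite x
    exact (hf.prod this).union (this.prod hf)
  have h1 : ∑' p : V × V, ENNReal.ofReal (G.μ p.1 p.2 * (f p.2 - f p.1) ^ 2)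
      = ∑ p ∈ hfin.toFinset, ENNReal.ofReal (G.μ p.1 p.2 * (f p.2 - f p.1) ^ 2) := by
    apply tsum_eq_sum
    rintro ⟨x, y⟩ hp
    by_cases hxy : G.Adj x y
    · have hx : f x = 0 := by
        by_contra hx
        exact hp (hfin.mem_toFinset.2 (Or.inl ⟨hx, Set.mem_biUnion (x := x) hx hxy⟩))
      have hy : f y = 0 := by
        by_contra hy
        exact hp (hfin.mem_toFinset.2
          (Or.inr ⟨Set.mem_biUnion (x := y) hy (G.adj_symm _ _ hxy), hy⟩))
      simp [hx, hy]
    · simp [G.μ_eq_zero x y hxy]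
  rw [energy, h1]
  exact ENNReal.mul_lt_top (by simp) (ENNReal.sum_lt_top.2 fun p _ => ENNReal.ofReal_lt_top)

theorem edgeVec_add (f g : V → ℝ) (p : V × V) :
    G.edgeVec (f + g) p = G.edgeVec f p + G.edgeVec g p := by
  simp only [edgeVec, Pi.add_apply]; ring

theorem edgeVec_smul (c : ℝ) (f : V → ℝ) (p : V × V) :
    G.edgeVec (c • f) p = c * G.edgeVec f p := by
  simp only [edgeVec, Pi.smul_apply, smul_eq_mul]; ring

theorem energyForm_add_left {f g k : V → ℝ} (hf : G.energy f < ∞) (hg : G.energy g < ∞)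
    (hk : G.energy k < ∞) :
    G.energyForm (f + g) k = G.energyForm f k + G.energyForm g k := by
  rw [energyForm, energyForm, energyForm, ← mul_add, ← Summable.tsum_add]
  · congr 1
    refine tsum_congr fun p => ?_
    simp only [Pi.add_apply]; ring
  · have := lp.summable_inner (𝕜 := ℝ) (⟨_, G.memℓp_edgeVec hf⟩ : lp (fun _ : V × V => ℝ) 2)
      ⟨_, G.memℓp_edgeVec hk⟩
    refine this.congr fun p => ?_
    rw [← edgeVec_mul, mul_comm (G.edgeVec _ p)]; rfl
  · have := lp.summable_inner (𝕜 := ℝ) (⟨_, G.memℓp_edgeVec hg⟩ : lp (fun _ : V × V => ℝ) 2)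
      ⟨_, G.memℓp_edgeVec hk⟩
    refine this.congr fun p => ?_
    rw [← edgeVec_mul, mul_comm (G.edgeVec _ p)]; rfl

theorem energyForm_smul_left (c : ℝ) (f k : V → ℝ) :
    G.energyForm (c • f) k = c * G.energyForm f k := by
  rw [energyForm, energyForm, mul_left_comm, ← tsum_mul_left (a := c)]
  congr 1
  refine tsum_congr fun p => ?_
  simp only [Pi.smul_apply, smul_eq_mul]; ring

variable [MeasurableSpace V]

/-- The measure `m` on `V`, i.e. `∑_x m(x) δ_x`. -/
noncomputable def vertexMeasure : Measure V :=
  Measure.sum fun x => ENNReal.ofReal (G.m x) • Measure.dirac x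

/-- The real Hilbert space `ℓ²(V, m)`. All points have positive mass, so its elements are honest
functions on `V`. -/
abbrev L2 : Type _ := Lp ℝ 2 G.vertexMeasure

/-- `D(Q^{(N)})`: the functions in `ℓ²(V, m)` of finite energy. -/
def neumannDomain : Set G.L2 := {f | G.energy f < ∞}

/-- `D(Q^{(D)})`: the closure of the finitely supported functions in `D(Q^{(N)})` with respect to
the form norm. -/
def dirichletDomain : Set G.L2 :=
  {f | f ∈ G.neumannDomain ∧ ∀ ε : ℝ≥0∞, 0 < ε →
    ∃ φ : V → ℝ, (Function.support φ).Finite ∧ G.formNormSq (f - φ) < ε}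

/-- `G.IsLaplacian f h` says that `f ∈ D(L)` and `L f = h`, where `L` is the (nonpositive)
self-adjoint operator associated with the closed form `Q^{(D)}`. -/
def IsLaplacian (f h : G.L2) : Prop :=
  f ∈ G.dirichletDomain ∧ ∀ g ∈ G.dirichletDomain, G.energyForm f g = - inner ℝ h g

variable [DiscreteMeasurableSpace V]

theorem vertexMeasure_singleton_pos (x : V) : 0 < G.vertexMeasure {x} := by
  refine lt_of_lt_of_le (ENNReal.ofReal_pos.2 (G.m_pos x))
    (le_trans ?_ (Measure.le_sum (fun x => ENNReal.ofReal (G.m x) • Measure.dirac x) x {x}))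
  simp

theorem vertexMeasure_singleton_lt_top (x : V) : G.vertexMeasure {x} < ∞ := by
  rw [vertexMeasure, Measure.sum_apply _ (measurableSet_singleton x), tsum_eq_single x]
  · simp
  · intro y hy
    simp [hy]

theorem forall_of_ae {p : V → Prop} (h : ∀ᵐ x ∂G.vertexMeasure, p x) (x : V) : p x := by
  by_contra hx
  have h1 : G.vertexMeasure {x} ≤ 0 := by
    rw [← ae_iff.1 h]
    exact measure_mono (by simpa using hx)
  exact absurd (G.vertexMeasure_singleton_pos x) (not_lt.2 h1)

theorem coe_add (f g : G.L2) : ⇑(f + g) = f + g := funext (G.forall_of_ae (Lp.coeFn_add f g))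
theorem coe_sub (f g : G.L2) : ⇑(f - g) = f - g := funext (G.forall_of_ae (Lp.coeFn_sub f g))
theorem coe_smul (c : ℝ) (f : G.L2) : ⇑(c • f) = c • ⇑f :=
  funext (G.forall_of_ae (Lp.coeFn_smul c f))
theorem coe_zero : ⇑(0 : G.L2) = 0 := funext (G.forall_of_ae (Lp.coeFn_zero ℝ 2 _))

theorem lintegral_vertexMeasure (F : V → ℝ≥0∞) :
    ∫⁻ x, F x ∂G.vertexMeasure = ∑' x, ENNReal.ofReal (G.m x) * F x := by
  rw [vertexMeasure, lintegral_sum_measure]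
  refine tsum_congr fun x => ?_
  rw [lintegral_smul_measure, lintegral_dirac, smul_eq_mul]

theorem tsum_sq_eq (f : G.L2) :
    ∑' x, ENNReal.ofReal (G.m x * f x ^ 2) = ENNReal.ofReal (‖f‖ ^ 2) := by
  rw [← real_inner_self_eq_norm_sq, L2.inner_def, ofReal_integral_eq_lintegral_ofReal
    (L2.integrable_inner f f) (Eventually.of_forall fun x => real_inner_self_nonneg),
    lintegral_vertexMeasure]
  refine tsum_congr fun x => ?_
  rw [ENNReal.ofReal_mul (G.m_pos x).le, real_inner_self_eq_norm_sq, Real.norm_eq_abs, sq_abs]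

theorem sq_le_norm (f : G.L2) (x : V) : G.m x * f x ^ 2 ≤ ‖f‖ ^ 2 := by
  have h := ENNReal.le_tsum (f := fun x => ENNReal.ofReal (G.m x * f x ^ 2)) x
  rw [G.tsum_sq_eq] at h
  exact (ENNReal.ofReal_le_ofReal_iff (by positivity)).1 h

theorem tendsto_apply {u : ℕ → G.L2} {f : G.L2} (h : Tendsto u atTop (𝓝 f)) (x : V) :
    Tendsto (fun n => u n x) atTop (𝓝 (f x)) := by
  have h1 : Tendsto (fun n => ‖u n - f‖ ^ 2 / G.m x) atTop (𝓝 0) := by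
    have := (((tendsto_sub_nhds_zero_iff.2 h).norm).pow 2).div_const (G.m x)
    simpa using this
  have h2 : Tendsto (fun n => (u n x - f x) ^ 2) atTop (𝓝 0) := by
    refine squeeze_zero (fun n => sq_nonneg _) (fun n => ?_) h1
    rw [le_div_iff₀ (G.m_pos x)]
    have := G.sq_le_norm (u n - f) x
    rw [coe_sub, Pi.sub_apply] at this
    linarith
  have h3 := (h2.sqrt)
  simp only [Real.sqrt_sq_eq_abs, Real.sqrt_zero] at h3
  exact tendsto_sub_nhds_zero_iff.1 ((tendsto_zero_iff_abs_tendsto_zero _).2 h3)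

theorem mem_dirichletDomain_of_finite {f : G.L2} (hf : (Function.support f).Finite) :
    f ∈ G.dirichletDomain :=
  ⟨G.energy_lt_top_of_finite hf, fun ε hε => ⟨f, hf, by simpa [formNormSq, energy] using hε⟩⟩

theorem dirichletDomain_add {f g : G.L2} (hf : f ∈ G.dirichletDomain)
    (hg : g ∈ G.dirichletDomain) : f + g ∈ G.dirichletDomain := by
  refine ⟨?_, fun ε hε => ?_⟩
  · change G.energy _ < ∞
    rw [coe_add]
    exact (G.energy_add_le f g).trans_lt (ENNReal.add_lt_top.2
      ⟨ENNReal.mul_lt_top (by simp) hf.1, ENNReal.mul_lt_top (by simp) hg.1⟩)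
  · have hε' : 0 < ε / 2 / 2 := by simp [hε.ne']
    obtain ⟨φ, hφ, h1⟩ := hf.2 _ hε'
    obtain ⟨ψ, hψ, h2⟩ := hg.2 _ hε'
    refine ⟨φ + ψ, (hφ.union hψ).subset (Function.support_add φ ψ), ?_⟩
    rw [coe_add, show (⇑f + ⇑g - (φ + ψ)) = (f - φ) + (g - ψ) by abel]
    refine (G.formNormSq_add_le _ _).trans_lt ?_
    calc _ < 2 * (ε / 2 / 2) + 2 * (ε / 2 / 2) :=
          ENNReal.add_lt_add ((ENNReal.mul_lt_mul_iff_right (by simp) (by simp)).2 h1)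
            ((ENNReal.mul_lt_mul_iff_right (by simp) (by simp)).2 h2)
      _ = ε := by rw [ENNReal.mul_div_cancel (by simp) (by simp), ENNReal.add_halves]

theorem dirichletDomain_smul (c : ℝ) {f : G.L2} (hf : f ∈ G.dirichletDomain) :
    c • f ∈ G.dirichletDomain := by
  rcases eq_or_ne c 0 with rfl | hc
  · rw [zero_smul]
    exact G.mem_dirichletDomain_of_finite (by rw [coe_zero]; simp)
  refine ⟨?_, fun ε hε => ?_⟩
  · change G.energy _ < ∞
    rw [coe_smul, energy_smul]
    exact ENNReal.mul_lt_top ENNReal.ofReal_lt_top hf.1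
  · have hc2 : ENNReal.ofReal (c ^ 2) ≠ 0 := (ENNReal.ofReal_pos.2 (by positivity)).ne'
    obtain ⟨φ, hφ, h1⟩ := hf.2 (ε / ENNReal.ofReal (c ^ 2)) (ENNReal.div_pos hε.ne' (by simp))
    refine ⟨c • φ, hφ.subset (Function.support_const_smul_subset c φ), ?_⟩
    rw [coe_smul, ← smul_sub, formNormSq_smul]
    calc _ < ENNReal.ofReal (c ^ 2) * (ε / ENNReal.ofReal (c ^ 2)) :=
          (ENNReal.mul_lt_mul_iff_right hc2 (by simp)).2 h1
      _ = ε := ENNReal.mul_div_cancel hc2 (by simp)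

theorem dirichletDomain_of_approx {f : G.L2}
    (hf : ∀ ε : ℝ≥0∞, 0 < ε → ∃ g ∈ G.dirichletDomain, G.formNormSq (f - g) < ε) :
    f ∈ G.dirichletDomain := by
  refine ⟨?_, fun ε hε => ?_⟩
  · obtain ⟨g, hg, h⟩ := hf 1 (by simp)
    change G.energy f < ∞
    have h1 := G.energy_add_le (f - g) g
    rw [sub_add_cancel] at h1
    have h2 : G.energy (f - g) < ∞ := lt_of_le_of_lt le_add_self (h.trans ENNReal.one_lt_top)
    exact h1.trans_lt (ENNReal.add_lt_top.2
      ⟨ENNReal.mul_lt_top (by simp) h2, ENNReal.mul_lt_top (by simp) hg.1⟩)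
  · have hε' : 0 < ε / 2 / 2 := by simp [hε.ne']
    obtain ⟨g, hg, h1⟩ := hf _ hε'
    obtain ⟨φ, hφ, h2⟩ := hg.2 _ hε'
    refine ⟨φ, hφ, ?_⟩
    rw [show (⇑f - φ) = (f - g) + (g - φ) by abel]
    refine (G.formNormSq_add_le _ _).trans_lt ?_
    calc _ < 2 * (ε / 2 / 2) + 2 * (ε / 2 / 2) :=
          ENNReal.add_lt_add ((ENNReal.mul_lt_mul_iff_right (by simp) (by simp)).2 h1)
            ((ENNReal.mul_lt_mul_iff_right (by simp) (by simp)).2 h2)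
      _ = ε := by rw [ENNReal.mul_div_cancel (by simp) (by simp), ENNReal.add_halves]

/-- The graph of the weighted gradient on `D(Q^{(D)})`. -/
noncomputable def gradGraph (c : ℝ) : Submodule ℝ (WithLp 2 (G.L2 × lp (fun _ : V × V => ℝ) 2)) where
  carrier := {z | z.fst ∈ G.dirichletDomain ∧ ∀ p, z.snd p = c * G.edgeVec z.fst p}
  add_mem' := by
    rintro a b ⟨h1, h2⟩ ⟨h3, h4⟩
    refine ⟨G.dirichletDomain_add h1 h3, fun p => ?_⟩
    simp only [WithLp.add_fst, WithLp.add_snd, coe_add, edgeVec_add, lp.coeFn_add, Pi.add_apply]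
    rw [h2, h4, mul_add]
  zero_mem' := by
    refine ⟨G.mem_dirichletDomain_of_finite ?_, fun p => ?_⟩
    · change (Function.support ⇑(0 : G.L2)).Finite
      rw [coe_zero]; simp
    · change 0 = c * G.edgeVec ⇑(0 : G.L2) p
      rw [coe_zero]; simp [edgeVec]
  smul_mem' := by
    rintro a b ⟨h1, h2⟩
    refine ⟨G.dirichletDomain_smul a h1, fun p => ?_⟩
    simp only [WithLp.smul_fst, WithLp.smul_snd, coe_smul, edgeVec_smul, lp.coeFn_smul,
      Pi.smul_apply, smul_eq_mul]
    rw [h2]; ring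

theorem isClosed_gradGraph {c : ℝ} (hc : 0 < c) : 
    IsClosed (G.gradGraph c : Set (WithLp 2 (G.L2 × lp (fun _ : V × V => ℝ) 2))) := by
  apply IsSeqClosed.isClosed
  intro u z hu hz
  have hz1 : Tendsto (fun n => (u n).fst) atTop (𝓝 z.fst) :=
    ((WithLp.prod_continuous_ofLp 2 _ _).tendsto z |>.comp hz).fst_nhds
  have hz2 : Tendsto (fun n => (u n).snd) atTop (𝓝 z.snd) :=
    ((WithLp.prod_continuous_ofLp 2 _ _).tendsto z |>.comp hz).snd_nhds
  have hgrad : ∀ p, z.snd p = c * G.edgeVec z.fst p := by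
    intro p
    have h1 : Tendsto (fun n => (u n).snd p) atTop (𝓝 (z.snd p)) := by
      rw [tendsto_iff_norm_sub_tendsto_zero] at hz2 ⊢
      refine squeeze_zero (fun n => norm_nonneg _) (fun n => ?_) hz2
      exact lp.norm_apply_le_norm (by norm_num) ((u n).snd - z.snd) p
    have h2 := ((G.tendsto_apply hz1 p.2).sub (G.tendsto_apply hz1 p.1)).const_mul
      (c * √(G.μ p.1 p.2))
    refine tendsto_nhds_unique h1 ?_
    have h3 : ∀ n, (u n).snd p = c * √(G.μ p.1 p.2) * ((u n).fst p.2 - (u n).fst p.1) := fun n => by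
      rw [(hu n).2 p, edgeVec, mul_assoc]
    simp only [h3, edgeVec, ← mul_assoc]
    exact h2
  refine ⟨G.dirichletDomain_of_approx fun ε hε => ?_, hgrad⟩
  have hnorm : ∀ n, G.formNormSq (z.fst - (u n).fst) = ENNReal.ofReal (‖z.fst - (u n).fst‖ ^ 2)
      + ENNReal.ofReal (2⁻¹ * ‖z.snd - (u n).snd‖ ^ 2 / c ^ 2) := by
    intro n
    rw [formNormSq, ← coe_sub, tsum_sq_eq]
    congr 1
    have h := G.energy_eq_of_edge (f := (z.fst - (u n).fst : G.L2)) (c := c)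
      (z := z.snd - (u n).snd) (fun p => by
        rw [lp.coeFn_sub, Pi.sub_apply, hgrad, (hu n).2, coe_sub]
        simp only [edgeVec, Pi.sub_apply]; ring)
    have hc2 : (0 : ℝ) < c ^ 2 := by positivity
    rw [ENNReal.ofReal_div_of_pos hc2, ENNReal.ofReal_mul (by norm_num),
      ENNReal.ofReal_inv_of_pos (by norm_num), ENNReal.ofReal_ofNat, ← h]
    rw [ENNReal.eq_div_iff (ENNReal.ofReal_pos.2 hc2).ne' (by simp)]
  have hlim : Tendsto (fun n => G.formNormSq (z.fst - (u n).fst)) atTop (𝓝 0) := by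
    simp only [hnorm]
    have h1 : Tendsto (fun n => ‖z.fst - (u n).fst‖) atTop (𝓝 0) := by
      have := (tendsto_const_nhds (x := z.fst)).sub hz1 |>.norm
      simpa using this
    have h2 : Tendsto (fun n => ‖z.snd - (u n).snd‖) atTop (𝓝 0) := by
      have := (tendsto_const_nhds (x := z.snd)).sub hz2 |>.norm
      simpa using this
    have h3 := (ENNReal.tendsto_ofReal (h1.pow 2)).add
      (ENNReal.tendsto_ofReal (((h2.pow 2).const_mul 2⁻¹).div_const (c ^ 2)))
    simpa using h3
  obtain ⟨n, hn⟩ := (hlim.eventually (gt_mem_nhds hε)).exists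
  exact ⟨_, (hu n).1, hn⟩

/-- The graph of `L`, as a linear subspace. -/
noncomputable def laplacianGraph : Submodule ℝ (G.L2 × G.L2) where
  carrier := {z | G.IsLaplacian z.1 z.2}
  add_mem' := by
    rintro a b ⟨h1, h2⟩ ⟨h3, h4⟩
    refine ⟨G.dirichletDomain_add h1 h3, fun g hg => ?_⟩
    rw [Prod.fst_add, Prod.snd_add, coe_add, G.energyForm_add_left h1.1 h3.1 hg.1, h2 g hg, h4 g hg,
      inner_add_left]
    ring
  zero_mem' := by
    refine ⟨G.mem_dirichletDomain_of_finite ?_, fun g hg => ?_⟩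
    · change (Function.support ⇑(0 : G.L2)).Finite
      rw [coe_zero]; simp
    · change G.energyForm ⇑(0 : G.L2) g = - inner ℝ (0 : G.L2) g
      rw [coe_zero, inner_zero_left]; simp [energyForm]
  smul_mem' := by
    rintro c a ⟨h1, h2⟩
    refine ⟨G.dirichletDomain_smul c h1, fun g hg => ?_⟩
    rw [Prod.smul_fst, Prod.smul_snd, coe_smul, energyForm_smul_left, h2 g hg,
      real_inner_smul_left]
    ring

theorem isLaplacian_zero {h : G.L2} (hh : G.IsLaplacian 0 h) : h = 0 := by
  apply Lp.ext
  refine Eventually.of_forall fun x => ?_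
  have hx := (G.vertexMeasure_singleton_lt_top x).ne
  set g : G.L2 := indicatorConstLp 2 (measurableSet_singleton x) hx (1 : ℝ) with hg
  have hgc : ⇑g = Set.indicator {x} fun _ => (1 : ℝ) :=
    funext (G.forall_of_ae indicatorConstLp_coeFn)
  have h1 := hh.2 g (G.mem_dirichletDomain_of_finite (by
    rw [hgc]
    exact (Set.finite_singleton x).subset Set.support_indicator_subset))
  have h2 : inner ℝ g h = ∫ y in {x}, h y ∂G.vertexMeasure :=
    L2.inner_indicatorConstLp_one (𝕜 := ℝ) (measurableSet_singleton x) hx h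
  rw [integral_singleton, real_inner_comm, smul_eq_mul] at h2
  rw [coe_zero, h2] at h1
  have h3 : G.vertexMeasure.real {x} ≠ 0 :=
    (ENNReal.toReal_pos (G.vertexMeasure_singleton_pos x).ne' hx).ne'
  have h4 : G.energyForm 0 g = 0 := by simp [energyForm]
  rw [h4] at h1
  have h5 : h x = 0 := by
    rcases mul_eq_zero.1 (neg_eq_zero.1 h1.symm) with h | h
    · exact absurd h h3
    · exact h
  rw [h5, coe_zero]
  rfl

theorem isLaplacian_dissipative {f h : G.L2} (hf : G.IsLaplacian f h) : inner ℝ h f ≤ 0 := by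
  have h1 := hf.2 f hf.1
  have h2 : 0 ≤ G.energyForm f f := by
    rw [energyForm]
    refine mul_nonneg (by norm_num) (tsum_nonneg fun p => ?_)
    exact mul_nonneg (G.μ_nonneg _ _) (mul_self_nonneg _)
  linarith

theorem exists_resolvent {r : ℝ} (hr : 0 < r) : ∃ J : G.L2 →L[ℝ] G.L2,
    (∀ g, ‖J g‖ ≤ ‖g‖) ∧ ∀ g, G.IsLaplacian (J g) (r • (J g - g)) := by
  set c : ℝ := √(2 * r)⁻¹ with hc
  have hcpos : 0 < c := Real.sqrt_pos.2 (by positivity)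
  have hc2 : c ^ 2 = (2 * r)⁻¹ := Real.sq_sqrt (by positivity)
  set K := G.gradGraph c with hK
  have : CompleteSpace K := (G.isClosed_gradGraph hcpos).completeSpace_coe
  set T : G.L2 →L[ℝ] G.L2 := (WithLp.fstL 2 ℝ G.L2 (lp (fun _ : V × V => ℝ) 2)) ∘L
    K.starProjection ∘L (WithLp.prodContinuousLinearEquiv 2 ℝ G.L2
      (lp (fun _ : V × V => ℝ) 2)).symm.toContinuousLinearMap ∘L
      (ContinuousLinearMap.inl ℝ G.L2 (lp (fun _ : V × V => ℝ) 2)) with hT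
  have hTapp : ∀ g, T g = (K.starProjection (WithLp.toLp 2 (g, 0))).fst := fun g => rfl
  refine ⟨T, fun g => ?_, fun g => ?_⟩
  · rw [hTapp]
    refine (WithLp.norm_fst_le _ _).trans ((K.norm_starProjection_apply_le _).trans ?_)
    simp
  · set u := K.starProjection (WithLp.toLp 2 (g, 0)) with hu
    have huK : u ∈ K := K.starProjection_apply_mem _
    rw [hTapp]
    refine ⟨huK.1, fun k hk => ?_⟩
    set w : lp (fun _ : V × V => ℝ) 2 := c • ⟨_, G.memℓp_edgeVec hk.1⟩ with hw
    have hwp : ∀ p, w p = c * G.edgeVec k p := fun p => rfl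
    have h1 : inner ℝ (WithLp.toLp 2 (g, 0) - u) (WithLp.toLp 2 (k, w)) = 0 := by
      apply K.starProjection_inner_eq_zero
      exact ⟨hk, hwp⟩
    rw [WithLp.prod_inner_apply] at h1
    have h2 := G.energyForm_eq_of_edge huK.2 hwp
    have h3 : inner ℝ (g - u.fst) k + inner ℝ (0 - u.snd) w = 0 := h1
    rw [hc2] at h2
    rw [inner_sub_left, inner_sub_left, inner_zero_left] at h3
    rw [real_inner_smul_left, inner_sub_left]
    have h4 : G.energyForm u.fst k = r * inner ℝ u.snd w := by
      field_simp at h2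
      linarith
    rw [h4]
    linear_combination (-r) * h3

theorem exists_heatSemigroup : ∃ P : ℝ → G.L2 →L[ℝ] G.L2,
    IsC0Semigroup P ∧ IsInfinitesimalGenerator G.IsLaplacian P := by
  choose J hJ1 hJ using fun n : ℕ => G.exists_resolvent (r := (n : ℝ) + 1) (by positivity)
  exact exists_semigroup G.laplacianGraph (fun h hh => G.isLaplacian_zero hh)
    (fun f h hf => G.isLaplacian_dissipative hf) J hJ1 hJ

/-- The heat semigroup `P_t = e^{tL}`, `t ≥ 0`: the `C₀`-semigroup on `ℓ²(V, m)` whose infinitesimal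
generator is `L`. A `C₀`-semigroup is determined by its generator. -/
noncomputable def heatSemigroup : ℝ → G.L2 →L[ℝ] G.L2 := G.exists_heatSemigroup.choose

theorem heatSemigroup_spec : IsC0Semigroup G.heatSemigroup ∧
    IsInfinitesimalGenerator G.IsLaplacian G.heatSemigroup :=
  G.exists_heatSemigroup.choose_spec

end WeightedGraph

/-! The two assertions have separate reasons.

Equality of the domains comes from cutting off with `η k`. By the Leibniz rule, the energy of `(1 -
η k) f` is at most a series in which each term of the energy of `f` is weighted by `(1 - η k)²`,
plus a series in which `f²` multiplies the squared differences of `η k`. Dominated convergence kills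
the first, because monotonicity bounds `(1 - η k)²` uniformly. The bound on `Γ` makes the second
`O(1/k) ‖f‖²`. Hence `η k * f → f` in the form norm (`energy_mul_le`, `tsum_sq_mul_edge_le`).

Decay of the energy on `D(Q^{(D)})` is a Hilbert space fact. If `f` and `L f` lie in `D(L)`, then
`Q(P_s f) = -⟨L P_s f, P_s f⟩` has right derivative `-2 ‖L P_s f‖² ≤ 0`. A general `f` is replaced
by `J_n² f`, where `J_n = r (r - L)⁻¹` with `r = n + 1`. This lies in `D(L²)`, has energy at most
`Q(f)` and tends to `f` in `ℓ²` (`resolvent_estimate`). Convergence in `ℓ²` implies pointwise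
convergence, along which the energy is lower semicontinuous, so the inequality survives the limit.
-/

/-! ### Semigroup orbits that start in the domain of the generator. -/

/-- Since `P t` commutes with every `P s`, it carries the difference quotient of `f` to that of `P t
f`; continuity of `P t` passes to the limit. -/
theorem IsC0Semigroup.generator_apply {E : Type*} [NormedAddCommGroup E] [InnerProductSpace ℝ E]
    [CompleteSpace E] {A : E → E → Prop} {P : ℝ → E →L[ℝ] E} (hP : IsC0Semigroup P)
    (hA : IsInfinitesimalGenerator A P) {f h : E} (hf : A f h) {t : ℝ} (ht : 0 ≤ t) :
    A (P t f) (P t h) := by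
  rw [hA] at hf ⊢
  refine (((P t).continuous.tendsto h).comp hf).congr' ?_
  filter_upwards [self_mem_nhdsWithin] with s hs
  have hs0 : (0 : ℝ) ≤ s := le_of_lt hs
  have h1 : P s (P t f) = P t (P s f) := by
    rw [← mul_apply_eq_comp, ← mul_apply_eq_comp, ← hP.add s t hs0 ht, ← hP.add t s ht hs0,
      add_comm]
  rw [Function.comp_apply, map_smul, map_sub, h1]

/-- For `s > t` the increment is `P (s - t) (P t f) - P t f`, so this is the generator limit at `P t
f`. The right derivative is all that the monotonicity argument for the energy needs. -/
theorem IsC0Semigroup.hasDerivWithinAt {E : Type*} [NormedAddCommGroup E] [InnerProductSpace ℝ E]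
    [CompleteSpace E] {A : E → E → Prop} {P : ℝ → E →L[ℝ] E} (hP : IsC0Semigroup P)
    (hA : IsInfinitesimalGenerator A P) {f h : E} (hf : A f h) {t : ℝ} (ht : 0 ≤ t) :
    HasDerivWithinAt (fun s => P s f) (P t h) (Set.Ici t) t := by
  have h1 := (hA _ _).1 (hP.generator_apply hA hf ht)
  rw [← hasDerivWithinAt_Ioi_iff_Ici, hasDerivWithinAt_iff_tendsto_slope' (by simp)]
  have h2 : Tendsto (fun s : ℝ => s - t) (𝓝[>] t) (𝓝[>] 0) := by
    refine tendsto_nhdsWithin_iff.2 ⟨?_, ?_⟩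
    · have : Tendsto (fun s : ℝ => s - t) (𝓝 t) (𝓝 (t - t)) := tendsto_id.sub_const t
      rw [sub_self] at this
      exact this.mono_left nhdsWithin_le_nhds
    · filter_upwards [self_mem_nhdsWithin] with s hs
      exact sub_pos.2 (Set.mem_Ioi.1 hs)
  refine (h1.comp h2).congr' ?_
  filter_upwards [self_mem_nhdsWithin] with s hs
  have hs0 : t < s := hs
  rw [Function.comp_apply, slope_def_module, ← mul_apply_eq_comp,
    ← hP.add _ _ (sub_nonneg.2 hs0.le) ht, sub_add_cancel]

/-! ### Dominated convergence for nonnegative series. -/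

theorem summable_of_tsum_ofReal_ne_top {ι : Type*} {a : ι → ℝ} (ha : ∀ i, 0 ≤ a i)
    (h : ∑' i, ENNReal.ofReal (a i) ≠ ∞) : Summable a :=
  (ENNReal.summable_toReal h).congr fun i => ENNReal.toReal_ofReal (ha i)

/-- Dominated convergence with majorant `C * a i`. It is applied with `c` a squared cutoff error,
once over vertices and once over pairs of vertices. -/
theorem tendsto_tsum_ofReal_mul_zero {ι : Type*} {a : ι → ℝ} (ha : ∀ i, 0 ≤ a i)
    (h : ∑' i, ENNReal.ofReal (a i) ≠ ∞) {c : ℕ → ι → ℝ} {C : ℝ} (hc : ∀ n i, 0 ≤ c n i)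
    (hC : ∀ n i, c n i ≤ C) (hlim : ∀ i, Tendsto (fun n => c n i) atTop (𝓝 0)) :
    Tendsto (fun n => ∑' i, ENNReal.ofReal (c n i * a i)) atTop (𝓝 0) := by
  have hs : Summable fun i => C * a i := (summable_of_tsum_ofReal_ne_top ha h).mul_left C
  have h0 : ∀ n i, 0 ≤ c n i * a i := fun n i => mul_nonneg (hc n i) (ha i)
  have hle : ∀ n i, c n i * a i ≤ C * a i := fun n i => mul_le_mul_of_nonneg_right (hC n i) (ha i)
  have h1 : Tendsto (fun n => ∑' i, c n i * a i) atTop (𝓝 (∑' _ : ι, (0 : ℝ))) := by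
    refine tendsto_tsum_of_dominated_convergence hs (fun i => ?_)
      (Eventually.of_forall fun n i => ?_)
    · simpa using (hlim i).mul_const (a i)
    · rw [Real.norm_of_nonneg (h0 n i)]; exact hle n i
  rw [tsum_zero] at h1
  have h2 := ENNReal.tendsto_ofReal h1
  rw [ENNReal.ofReal_zero] at h2
  refine h2.congr fun n => ?_
  exact ENNReal.ofReal_tsum_of_nonneg (h0 n) (Summable.of_nonneg_of_le (h0 n) (hle n) hs)

/-! ### The energy of functions on the graph. -/

namespace WeightedGraph

variable {V : Type*} (G : WeightedGraph V)

theorem tsum_energy_ne_top {f : V → ℝ} (hf : G.energy f < ∞) :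
    ∑' p : V × V, ENNReal.ofReal (G.μ p.1 p.2 * (f p.2 - f p.1) ^ 2) ≠ ∞ := by
  intro h
  rw [energy, h, ENNReal.mul_top (by simp)] at hf
  exact lt_irrefl _ hf

/-- Finiteness matters: for infinite energy the real series is not summable and `energyForm f f`
takes the default value `0`. -/
theorem energy_eq_ofReal {f : V → ℝ} (hf : G.energy f < ∞) :
    G.energy f = ENNReal.ofReal (G.energyForm f f) := by
  have h0 : ∀ p : V × V, 0 ≤ G.μ p.1 p.2 * (f p.2 - f p.1) ^ 2 := fun p =>
    mul_nonneg (G.μ_nonneg _ _) (sq_nonneg _)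
  rw [energyForm, ENNReal.ofReal_mul (by norm_num), ENNReal.ofReal_inv_of_pos (by norm_num),
    ENNReal.ofReal_ofNat, energy]
  simp only [← sq]
  rw [ENNReal.ofReal_tsum_of_nonneg h0
    (summable_of_tsum_ofReal_ne_top h0 (G.tsum_energy_ne_top hf))]

theorem energyForm_self_nonneg (f : V → ℝ) : 0 ≤ G.energyForm f f :=
  mul_nonneg (by norm_num) (tsum_nonneg fun _ => mul_nonneg (G.μ_nonneg _ _) (mul_self_nonneg _))

theorem energyForm_comm (f g : V → ℝ) : G.energyForm f g = G.energyForm g f := by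
  rw [energyForm, energyForm]
  congr 1
  exact tsum_congr fun p => by ring

/-- Expand `0 ≤ Q(g - f)`; finite energies make the expansion legitimate. -/
theorem two_mul_energyForm_le {f g : V → ℝ} (hf : G.energy f < ∞) (hg : G.energy g < ∞) :
    2 * G.energyForm f g ≤ G.energyForm f f + G.energyForm g g := by
  have hnf : G.energy ((-1 : ℝ) • f) < ∞ := by
    rw [energy_smul]
    exact ENNReal.mul_lt_top ENNReal.ofReal_lt_top hf
  have hd : G.energy (g + (-1 : ℝ) • f) < ∞ :=
    (G.energy_add_le _ _).trans_lt (ENNReal.add_lt_top.2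
      ⟨ENNReal.mul_lt_top (by simp) hg, ENNReal.mul_lt_top (by simp) hnf⟩)
  have h := G.energyForm_self_nonneg (g + (-1 : ℝ) • f)
  rw [G.energyForm_add_left hg hnf hd, energyForm_smul_left, G.energyForm_comm g,
    G.energyForm_comm f, G.energyForm_add_left hg hnf hg, G.energyForm_add_left hg hnf hf,
    energyForm_smul_left, energyForm_smul_left, G.energyForm_comm g f] at h
  linarith

/-- Lower semicontinuity of the energy under pointwise convergence. -/
theorem energy_le_of_tendsto {u : ℕ → V → ℝ} {f : V → ℝ}
    (hu : ∀ x, Tendsto (fun n => u n x) atTop (𝓝 (f x))) {C : ℝ≥0∞}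
    (hC : ∀ n, G.energy (u n) ≤ C) : G.energy f ≤ C := by
  -- The energy is a supremum of finite partial sums, each of them continuous under pointwise
  -- convergence.
  rw [energy, ENNReal.tsum_eq_iSup_sum, ENNReal.mul_iSup]
  refine iSup_le fun s => ?_
  have h1 : Tendsto (fun n => 2⁻¹ * ∑ p ∈ s,
      ENNReal.ofReal (G.μ p.1 p.2 * (u n p.2 - u n p.1) ^ 2)) atTop
      (𝓝 (2⁻¹ * ∑ p ∈ s, ENNReal.ofReal (G.μ p.1 p.2 * (f p.2 - f p.1) ^ 2))) := by
    refine ENNReal.Tendsto.const_mul (tendsto_finsetSum _ fun p _ => ?_) (Or.inr (by simp))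
    exact ENNReal.tendsto_ofReal ((((hu p.2).sub (hu p.1)).pow 2).const_mul _)
  refine le_of_tendsto h1 (Eventually.of_forall fun n => le_trans ?_ (hC n))
  rw [energy]
  gcongr
  exact ENNReal.sum_le_tsum s

/-- Leibniz rule: the difference of `g f` from `x` to `y` is `g(y) (f(y) - f(x)) + f(x) (g(y) -
g(x))`. The factor `1/2` in the energy absorbs the `2` in `(a + b)² ≤ 2a² + 2b²`. -/
theorem energy_mul_le (g f : V → ℝ) : G.energy (g * f) ≤
    ∑' p : V × V, ENNReal.ofReal (g p.2 ^ 2 * (G.μ p.1 p.2 * (f p.2 - f p.1) ^ 2)) +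
    ∑' p : V × V, ENNReal.ofReal (f p.1 ^ 2 * (G.μ p.1 p.2 * (g p.2 - g p.1) ^ 2)) := by
  rw [energy, ← ENNReal.tsum_add, ← ENNReal.tsum_mul_left]
  refine ENNReal.tsum_le_tsum fun p => ?_
  have h := G.μ_nonneg p.1 p.2
  rw [show (2 : ℝ≥0∞)⁻¹ = ENNReal.ofReal 2⁻¹ by
    rw [ENNReal.ofReal_inv_of_pos (by norm_num), ENNReal.ofReal_ofNat],
    ← ENNReal.ofReal_mul (by norm_num), ← ENNReal.ofReal_add (by positivity) (by positivity)]
  apply ENNReal.ofReal_le_ofReal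
  simp only [Pi.mul_apply]
  -- With `a`, `b` the two Leibniz terms, `(a + b)² / 2 ≤ a² + b²` amounts to `(a - b)² ≥ 0`.
  nlinarith [mul_nonneg h (sq_nonneg (g p.2 * (f p.2 - f p.1) - f p.1 * (g p.2 - g p.1)))]

theorem tsum_ofReal_edge_eq (g : V → ℝ) (x : V) :
    ∑' y, ENNReal.ofReal (G.μ x y * (g y - g x) ^ 2) =
      ENNReal.ofReal (2 * G.m x * G.carreDuChamp g g x) := by
  have hm := (G.m_pos x).ne'
  have hs : Summable fun y => G.μ x y * (g y - g x) ^ 2 := by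
    refine summable_of_hasFiniteSupport ((G.locallyFinite x).subset fun y hy => ?_)
    by_contra h
    exact hy (by simp [G.μ_eq_zero x y h])
  rw [← ENNReal.ofReal_tsum_of_nonneg
    (fun y => mul_nonneg (G.μ_nonneg _ _) (sq_nonneg _)) hs, carreDuChamp, ← mul_assoc,
    mul_inv_cancel₀ (by positivity), one_mul]
  simp only [sq]

/-- Summing over the second endpoint first produces `2 m(x) Γ(g)(x) f(x)²`, so a uniform bound on
`Γ(g)` leaves a multiple of `‖f‖²`. -/
theorem tsum_sq_mul_edge_le {g : V → ℝ} {c : ℝ} (hg : ∀ x, G.carreDuChamp g g x ≤ c)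
    (f : V → ℝ) :
    ∑' p : V × V, ENNReal.ofReal (f p.1 ^ 2 * (G.μ p.1 p.2 * (g p.2 - g p.1) ^ 2)) ≤
      ENNReal.ofReal (2 * c) * ∑' x, ENNReal.ofReal (G.m x * f x ^ 2) := by
  rw [ENNReal.tsum_prod', ← ENNReal.tsum_mul_left]
  refine ENNReal.tsum_le_tsum fun x => ?_
  simp only [ENNReal.ofReal_mul (sq_nonneg (f x))]
  rw [ENNReal.tsum_mul_left, tsum_ofReal_edge_eq, ← ENNReal.ofReal_mul (sq_nonneg _),
    ← ENNReal.ofReal_mul' (mul_nonneg (G.m_pos x).le (sq_nonneg _))]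
  apply ENNReal.ofReal_le_ofReal
  have h := mul_le_mul_of_nonneg_left (hg x)
    (mul_nonneg (mul_nonneg zero_le_two (G.m_pos x).le) (sq_nonneg (f x)))
  linarith

theorem carreDuChamp_one_sub (g : V → ℝ) (x : V) :
    G.carreDuChamp (1 - g) (1 - g) x = G.carreDuChamp g g x := by
  rw [carreDuChamp, carreDuChamp]
  congr 1
  exact tsum_congr fun y => by simp only [Pi.sub_apply, Pi.one_apply]; ring

/-- A nondecreasing sequence of finitely supported functions with limit `1` is uniformly close
to `1` up to a constant. -/
theorem exists_one_sub_sq_le {η : ℕ → V → ℝ} (h0 : (Function.support (η 0)).Finite)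
    (hmono : Monotone η) (hlim : ∀ x, Tendsto (fun k => η k x) atTop (𝓝 1)) :
    ∃ C, ∀ k x, (1 - η k x) ^ 2 ≤ C := by
  -- The cutoffs may be negative, but `η 0` has finite range, and its lower bound is inherited by
  -- all later `η k`. The upper bound `1` is the limit of the nondecreasing sequence.
  obtain ⟨b, hb⟩ : ∃ b, ∀ x, b ≤ η 0 x := by
    have hfin : (Set.range (η 0)).Finite := by
      refine ((h0.image (η 0)).insert 0).subset ?_
      rintro _ ⟨x, rfl⟩
      by_cases hx : η 0 x = 0
      · exact Or.inl hx
      · exact Or.inr ⟨x, hx, rfl⟩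
    obtain ⟨b, hb⟩ := hfin.bddBelow
    exact ⟨b, fun x => hb ⟨x, rfl⟩⟩
  refine ⟨(1 - b) ^ 2, fun k x => ?_⟩
  have h1 : η k x ≤ 1 :=
    Monotone.ge_of_tendsto (f := fun k => η k x) (fun i j hij => hmono hij x) (hlim x) k
  have h2 : b ≤ η k x := (hb x).trans (hmono (Nat.zero_le k) x)
  exact pow_le_pow_left₀ (by linarith) (by linarith) 2

variable [MeasurableSpace V]

/-! ### Symmetry of the Laplacian and the resolvent estimate. -/

-- Symmetry of `L`: both sides equal `-Q(f, f')`.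
variable {G} in
theorem IsLaplacian.inner_comm {f f' h h' : G.L2} (h1 : G.IsLaplacian f h)
    (h2 : G.IsLaplacian f' h') : inner ℝ h f' = inner ℝ f h' := by
  have e1 := h1.2 f' h2.1
  have e2 := h2.2 f h1.1
  rw [energyForm_comm, e1, neg_inj] at e2
  rw [e2, real_inner_comm]

variable {G} in
theorem IsLaplacian.energy_eq {f h : G.L2} (hf : G.IsLaplacian f h) :
    G.energy f = ENNReal.ofReal (-inner ℝ h f) := by
  rw [G.energy_eq_ofReal hf.1.1, hf.2 f hf.1]

/-- The quadratic estimate for a resolvent value `u = J g` with `L u = r (u - g)`. -/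
theorem resolvent_estimate {r : ℝ} {u g : G.L2} (hu : G.IsLaplacian u (r • (u - g)))
    (hg : g ∈ G.dirichletDomain) :
    G.energyForm u u + 2 * r * ‖u - g‖ ^ 2 ≤ G.energyForm g g := by
  -- Testing the equation for `u` against `g` and against `u` and subtracting gives `Q(u, g) - Q(u,
  -- u) = r ‖u - g‖²`. Combining this with `2 Q(u, g) ≤ Q(u, u) + Q(g, g)` gives the claim.
  have h1 := hu.2 g hg
  have h2 := hu.2 u hu.1
  have h4 := G.two_mul_energyForm_le hu.1.1 hg.1
  have h3 : inner ℝ (u - g) u - inner ℝ (u - g) g = ‖u - g‖ ^ 2 := by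
    rw [← inner_sub_right, real_inner_self_eq_norm_sq]
  rw [real_inner_smul_left] at h1 h2
  have h5 := congrArg (r * ·) h3
  simp only [mul_sub] at h5
  linarith

variable [DiscreteMeasurableSpace V]

/-! ### Completeness makes finitely supported functions dense in the form norm. -/

theorem dirichletDomain_eq_neumannDomain (hG : G.IsComplete) :
    G.dirichletDomain = G.neumannDomain := by
  refine Set.Subset.antisymm (fun f hf => hf.1) fun f hf => ⟨hf, fun ε hε => ?_⟩
  obtain ⟨η, hfin, hmono, hlim, hΓ⟩ := hG
  obtain ⟨C, hC⟩ := exists_one_sub_sq_le (hfin 0) hmono hlim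
  have hlim0 : ∀ x, Tendsto (fun k => (1 - η k x) ^ 2) atTop (𝓝 0) := fun x => by
    simpa using ((hlim x).const_sub 1).pow 2
  have hnorm : ∑' x, ENNReal.ofReal (G.m x * f x ^ 2) ≠ ∞ := by
    rw [G.tsum_sq_eq]; exact ENNReal.ofReal_ne_top
  -- The three limits handle the `ℓ²` part of `(1 - η k) f` and the two Leibniz terms of its energy.
  have t1 := tendsto_tsum_ofReal_mul_zero
    (fun x => mul_nonneg (G.m_pos x).le (sq_nonneg (f x))) hnorm
    (c := fun k x => (1 - η k x) ^ 2) (fun _ _ => sq_nonneg _) hC hlim0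
  have t2 := tendsto_tsum_ofReal_mul_zero
    (fun p : V × V => mul_nonneg (G.μ_nonneg p.1 p.2) (sq_nonneg (f p.2 - f p.1)))
    (G.tsum_energy_ne_top hf)
    (c := fun k p => (1 - η k p.2) ^ 2) (fun _ _ => sq_nonneg _) (fun k p => hC k p.2)
    (fun p => hlim0 p.2)
  -- The coefficient is the `2 * c` of `tsum_sq_mul_edge_le` with `c = 1 / (k + 1)`, the bound on
  -- `Γ(η k)` when indexing starts at `0`.
  have t3 : Tendsto (fun k : ℕ => ENNReal.ofReal (2 * (1 / ((k : ℝ) + 1))) *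
      ∑' x, ENNReal.ofReal (G.m x * f x ^ 2)) atTop (𝓝 0) := by
    have h1 := ENNReal.tendsto_ofReal
      ((tendsto_one_div_add_atTop_nhds_zero_nat (𝕜 := ℝ)).const_mul 2)
    rw [mul_zero, ENNReal.ofReal_zero] at h1
    simpa using ENNReal.Tendsto.mul_const h1 (Or.inr hnorm)
  have t4 := t1.add (t2.add t3)
  rw [add_zero, add_zero] at t4
  obtain ⟨k, hk⟩ := (t4.eventually (gt_mem_nhds hε)).exists
  refine ⟨η k * f, (hfin k).subset (Function.support_mul_subset_left _ _), lt_of_le_of_lt ?_ hk⟩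
  have e : (f : V → ℝ) - η k * f = (1 - η k) * f := by rw [sub_mul, one_mul]
  rw [e, formNormSq]
  refine add_le_add (le_of_eq (tsum_congr fun x => ?_)) ((G.energy_mul_le _ _).trans
    (add_le_add le_rfl (G.tsum_sq_mul_edge_le (fun x => ?_) f)))
  · congr 1
    simp only [Pi.mul_apply, Pi.sub_apply, Pi.one_apply]
    ring
  · rw [carreDuChamp_one_sub]
    exact hΓ k x

/-! ### Decay of the energy along the heat flow. -/

variable {G} in
theorem IsLaplacian.add {f f' h h' : G.L2} (h1 : G.IsLaplacian f h) (h2 : G.IsLaplacian f' h') :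
    G.IsLaplacian (f + f') (h + h') :=
  G.laplacianGraph.add_mem (x := (f, h)) (y := (f', h')) h1 h2

variable {G} in
theorem IsLaplacian.smul (c : ℝ) {f h : G.L2} (h1 : G.IsLaplacian f h) :
    G.IsLaplacian (c • f) (c • h) :=
  G.laplacianGraph.smul_mem c (x := (f, h)) h1

/-- The energy decreases along the heat flow started in the domain of `L ^ 2`. -/
theorem energy_heatSemigroup_le_of_isLaplacian {f h k : G.L2} (hf : G.IsLaplacian f h)
    (hh : G.IsLaplacian h k) {t : ℝ} (ht : 0 ≤ t) :
    G.energy (G.heatSemigroup t f) ≤ G.energy f := by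
  obtain ⟨hP, hA⟩ := G.heatSemigroup_spec
  rw [(hP.generator_apply hA hf ht).energy_eq, hf.energy_eq]
  apply ENNReal.ofReal_le_ofReal
  have hcont : ∀ g : G.L2, ContinuousOn (fun s => G.heatSemigroup s g) (Set.Icc 0 t) :=
    fun g => (hP.continuousOn g).mono Set.Icc_subset_Ici_self
  -- The function `s ↦ -⟨P_s h, P_s f⟩ = Q(P_s f)` is compared with its initial value.
  -- Differentiating both factors requires `h = L f` to lie in `D(L)` too. By symmetry of `L` the
  -- two terms of the derivative agree, with sum `-2 ‖P_s h‖²`.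
  have key := image_le_of_deriv_right_le_deriv_boundary
    (f := fun s => -inner ℝ (G.heatSemigroup s h) (G.heatSemigroup s f))
    (f' := fun s => -(inner ℝ (G.heatSemigroup s h) (G.heatSemigroup s h) +
      inner ℝ (G.heatSemigroup s k) (G.heatSemigroup s f)))
    (B := fun _ => -inner ℝ h f) (B' := fun _ => 0) (a := 0) (b := t)
    ((hcont h).inner (𝕜 := ℝ) (hcont f)).neg
    (fun s hs => ((hP.hasDerivWithinAt hA hh hs.1).inner ℝ
      (hP.hasDerivWithinAt hA hf hs.1)).neg)
    (by simp [hP.zero]) continuousOn_const (fun s _ => hasDerivWithinAt_const _ _ _)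
    (fun s hs => by
      have e := (hP.generator_apply hA hh hs.1).inner_comm (hP.generator_apply hA hf hs.1)
      rw [e]
      have := real_inner_self_nonneg (x := G.heatSemigroup s h)
      linarith)
  exact key (Set.right_mem_Icc.2 ht)

/-- Regularization by `J n ∘ J n` reduces to the domain of `L²`. Since the resolvents do not
increase the energy and lower semicontinuity closes the argument, convergence in `ℓ²` suffices. -/
theorem energy_heatSemigroup_le {f : G.L2} (hf : f ∈ G.dirichletDomain) {t : ℝ} (ht : 0 ≤ t) :
    G.energy (G.heatSemigroup t f) ≤ G.energy f := by
  choose J hJ1 hJ using fun n : ℕ => G.exists_resolvent (r := (n : ℝ) + 1) (by positivity)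
  have hJE : ∀ n, ∀ g ∈ G.dirichletDomain, G.energy (J n g) ≤ G.energy g := by
    intro n g hg
    have h1 := G.resolvent_estimate (hJ n g) hg
    rw [G.energy_eq_ofReal (hJ n g).1.1, G.energy_eq_ofReal hg.1]
    apply ENNReal.ofReal_le_ofReal
    have : 0 ≤ 2 * ((n : ℝ) + 1) * ‖J n g - g‖ ^ 2 := by positivity
    linarith
  have hJlim : Tendsto (fun n => J n f) atTop (𝓝 f) := by
    rw [tendsto_iff_norm_sub_tendsto_zero]
    -- The resolvent estimate with `r = n + 1` bounds this by `Q(f) / (2 (n + 1))`; the cruder `Q(f)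
    -- / (n + 1)` is enough.
    have h1 : Tendsto (fun n => ‖J n f - f‖ ^ 2) atTop (𝓝 0) := by
      have h2 := (tendsto_one_div_add_atTop_nhds_zero_nat (𝕜 := ℝ)).const_mul
        (G.energyForm f f)
      rw [mul_zero] at h2
      refine squeeze_zero (fun n => sq_nonneg _) (fun n => ?_) h2
      have h3 := G.resolvent_estimate (hJ n f) hf
      have h4 := G.energyForm_self_nonneg (J n f)
      rw [mul_one_div, le_div_iff₀ (by positivity)]
      have : 0 ≤ ((n : ℝ) + 1) * ‖J n f - f‖ ^ 2 := by positivity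
      linarith
    simpa using h1.sqrt
  have hJJlim : Tendsto (fun n => J n (J n f)) atTop (𝓝 f) := by
    -- Contractivity of `J n` allows the operator to vary with `n` along with its argument.
    have h1 : Tendsto (fun n => J n (J n f - f)) atTop (𝓝 0) :=
      squeeze_zero_norm (fun n => hJ1 n _) (tendsto_iff_norm_sub_tendsto_zero.1 hJlim)
    simpa using h1.add hJlim
  refine G.energy_le_of_tendsto (u := fun n => G.heatSemigroup t (J n (J n f)))
    (G.tendsto_apply (((G.heatSemigroup t).continuous.tendsto f).comp hJJlim)) fun n => ?_
  have h1 := hJ n (J n f)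
  -- `L` maps `J n (J n f)` to `(n + 1) (J n (J n f) - J n f)`, a combination of resolvent values
  -- and so again in `D(L)`. One application of `J n` would give only `D(L)`.
  have h2 := ((h1.add ((hJ n f).smul (-1))).smul ((n : ℝ) + 1))
  rw [neg_one_smul ℝ (J n f), ← sub_eq_add_neg] at h2
  exact (G.energy_heatSemigroup_le_of_isLaplacian h1 h2 ht).trans
    ((hJE n _ (hJ n f).1).trans (hJE n f hf))

end WeightedGraph

theorem propositionp {V : Type*} [MeasurableSpace V] [DiscreteMeasurableSpace V]
    (G : WeightedGraph V) (hG : G.IsComplete) :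
    G.dirichletDomain = G.neumannDomain ∧
    (∀ f : G.L2, (Function.support f).Finite → ∀ t : ℝ, 0 ≤ t →
      G.energy (G.heatSemigroup t f) ≤ G.energy f) ∧
    (∀ f ∈ G.neumannDomain, ∀ t : ℝ, 0 ≤ t →
      G.energy (G.heatSemigroup t f) ≤ G.energy f) := by
  have h := G.dirichletDomain_eq_neumannDomain hG
  refine ⟨h, fun f hf t ht => ?_, fun f hf t ht => ?_⟩
  · exact G.energy_heatSemigroup_le (G.mem_dirichletDomain_of_finite hf) ht
  · exact G.energy_heatSemigroup_le (h ▸ hf) ht
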